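/- Let $I=[0,1]$ and let $\mathrm{Homeo}^+(I)$ be the group of orientation-preserving homeomorphisms of $I$. For $h\in\mathrm{Homeo}^+(I)$ write $\mathrm{supp}\,h=\{x\in I\mid h(x)\neq x\}$. Let \[F=\langle A,B\mid [A,(AB)^{-1}B(AB)],\ [A,(AB)^{-2}B(AB)^{2}]\rangle\] be Thompson's group. A subgroup $G<\mathrm{Homeo}^+(I)$ is called a square root of $F$ if there are $f,g\in\mathrm{Homeo}^+(I)$ such that $G=\langle f,g\rangle$, such that $\langle f^2,g^2\rangle\cong F$, and such that $\mathrm{supp}\,f$ and $\mathrm{supp}\,g$ are nonempty open intervals whose intersection is a nonempty proper subinterval of each of them. Then there exists a square root $G$ of $F$ that contains a nonabelian free group of rank two; that is, there is an injective homomorphism from the free group on two generators into $G$. -/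

import Mathlib

/-- The closed unit interval `I = [0,1]`. -/
abbrev I01 : Type := Set.Icc (0 : ℝ) 1

/-- `Homeo⁺(I)`: the group of orientation-preserving homeomorphisms of `I = [0,1]`,
with composition as multiplication. -/
def HomeoPlus : Subgroup (I01 ≃ₜ I01) where
  carrier := {h | StrictMono h}
  mul_mem' {a b} ha hb := by
    intro x y hxy
    exact ha (hb hxy)
  one_mem' := by
    intro x y hxy
    exact hxy
  inv_mem' {a} ha := by
    intro x y hxy
    have h : a.symm x < a.symm y := by
      rw [← StrictMono.lt_iff_lt ha]
      simpa using hxy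
    exact h

/-- The (open) support of a homeomorphism: the set of points that it moves. -/
def homeoSupp (h : HomeoPlus) : Set I01 := {x | (h : I01 ≃ₜ I01) x ≠ x}

/-- Two nonempty open intervals form a two-chain if their intersection is a nonempty proper
subset of each of them (the intersection is then automatically an open interval). -/
def IsTwoChain (J K : Set I01) : Prop :=
  (∃ a b : I01, a < b ∧ J = Set.Ioo a b) ∧
  (∃ a b : I01, a < b ∧ K = Set.Ioo a b) ∧
  (J ∩ K).Nonempty ∧ J ∩ K ⊂ J ∧ J ∩ K ⊂ K

open scoped commutatorElement in
/-- The relators `[A, (AB)⁻ᵏ B (AB)ᵏ]`, `k = 1, 2`, of Thompson's group `F`, in the free group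
on `A = of 0` and `B = of 1`. -/
def thompsonRels : Set (FreeGroup (Fin 2)) :=
  let A := FreeGroup.of (0 : Fin 2)
  let B := FreeGroup.of (1 : Fin 2)
  {⁅A, ((A * B) ^ 1)⁻¹ * B * (A * B) ^ 1⁆, ⁅A, ((A * B) ^ 2)⁻¹ * B * (A * B) ^ 2⁆}

/-- Thompson's group `F = ⟨A, B | [A, (AB)⁻¹B(AB)], [A, (AB)⁻²B(AB)²]⟩`. -/
abbrev ThompsonF : Type := PresentedGroup thompsonRels

/-- `G < Homeo⁺(I)` is a square root of Thompson's group `F`: `G = ⟨f, g⟩`, where the supports of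
`f` and `g` form a two-chain of intervals and `⟨f², g²⟩ ≅ F`. -/
def IsSquareRootOfF (G : Subgroup HomeoPlus) : Prop :=
  ∃ f g : HomeoPlus,
    G = Subgroup.closure {f, g} ∧
    IsTwoChain (homeoSupp f) (homeoSupp g) ∧
    Nonempty (Subgroup.closure {f ^ 2, g ^ 2} ≃* ThompsonF)

/-! The isomorphism type of `⟨f², g²⟩` depends only on coarse dynamics. Work on `ℝ`, whose order
automorphisms embed in `HomeoPlus`. Suppose `a` moves left exactly the points below `c`, `b` moves
left exactly those above `p < c`, and `(ab)⁻¹ p ≥ c`. Then `⟨a, b⟩` is Thompson's group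
(`IsThompsonPair.nonempty_mulEquiv`). The relations hold because the supports involved are disjoint.
Faithfulness holds because every element of `F` is a fraction of sorted positive words `x₀^a₀ x₁^a₁
⋯`, whose exponents can be read off from the orbits of the points `(ab)⁻ⁱ p`.

This leaves room to modify `g` away from the orbit of `p` that is used. Both `leftMap` and
`rightMap` are translations by 4 near `(-1, 1)` and `(3, 5)`; composing `rightMap` with an arbitrary
automorphism of these two intervals leaves the supports and the relevant orbit unchanged. The
discrepancy between `leftMap` and `twistedMap` then acts on `(-1, 1)` through a chosen free pair,
built by ping-pong (`injective_lift_ping_pong`), so `⟨f, g⟩` contains a free group although `⟨f²,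
g²⟩ ≅ F`. The generators are the inverses of these maps, so that they push points to the left. -/

/-- The standard infinite family of generators built from `a` and `b`: `x₀ = a b` and
`xₙ₊₁ = x₀⁻ⁿ b x₀ⁿ`. -/
def thompsonGen {G : Type*} [Group G] (a b : G) : ℕ → G
  | 0 => a * b
  | n + 1 => ((a * b) ^ n)⁻¹ * b * (a * b) ^ n

/-! ### The infinite presentation of `F` from its two relators. -/

section Relations

variable {G : Type*} [Group G] {a b : G}

theorem thompsonGen_conj (m k : ℕ) :
    thompsonGen a b (m + 1 + k) =
      (thompsonGen a b 0 ^ k)⁻¹ * thompsonGen a b (m + 1) * thompsonGen a b 0 ^ k := by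
  rw [show m + 1 + k = (m + k) + 1 by ring]
  simp only [thompsonGen, pow_add]
  group

/-- Passing to the next generator is conjugation by `x₀ = ab`; when `a` commutes with the generator,
only the conjugation by `b = x₁` remains. -/
theorem thompsonGen_mul_one_of_commute {m : ℕ} (h : Commute a (thompsonGen a b (m + 2))) :
    thompsonGen a b (m + 2) * thompsonGen a b 1 =
      thompsonGen a b 1 * thompsonGen a b (m + 3) := by
  have h3 : thompsonGen a b (m + 3) = (a * b)⁻¹ * thompsonGen a b (m + 2) * (a * b) := by
    have := thompsonGen_conj (a := a) (b := b) (m + 1) 1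
    simpa [thompsonGen] using this
  have h1 : thompsonGen a b 1 = b := by simp [thompsonGen]
  rw [h3, h1]
  have h' : a⁻¹ * thompsonGen a b (m + 2) * a = thompsonGen a b (m + 2) := by
    rw [mul_assoc, ← h.eq, inv_mul_cancel_left]
  calc thompsonGen a b (m + 2) * b
      = a⁻¹ * thompsonGen a b (m + 2) * a * b := by rw [h']
    _ = b * ((a * b)⁻¹ * thompsonGen a b (m + 2) * (a * b)) := by group

/-- The two defining relations propagate to all the later generators. -/
theorem commute_thompsonGen (h2 : Commute a (thompsonGen a b 2))
    (h3 : Commute a (thompsonGen a b 3)) (m : ℕ) : Commute a (thompsonGen a b (m + 2)) := by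
  induction m using Nat.strong_induction_on with
  | _ m ih =>
    match m with
    | 0 => exact h2
    | 1 => exact h3
    | m + 2 =>
      have e := thompsonGen_mul_one_of_commute (ih m (by omega))
      -- Conjugating `e` by `x₀` shifts every index by one. It expresses `x_{m+4}` through `x₂` and
      -- `x_{m+3}`, which both commute with `a`.
      have e' : thompsonGen a b (m + 3) * thompsonGen a b 2 =
          thompsonGen a b 2 * thompsonGen a b (m + 4) := by
        have c1 := thompsonGen_conj (a := a) (b := b) (m + 1) 1
        have c2 := thompsonGen_conj (a := a) (b := b) 0 1
        have c3 := thompsonGen_conj (a := a) (b := b) (m + 2) 1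
        simp only [zero_add, pow_one, add_assoc, Nat.reduceAdd] at c1 c2 c3
        rw [c1, c2, c3]
        calc _ = (thompsonGen a b 0)⁻¹ * (thompsonGen a b (m + 2) * thompsonGen a b 1) *
              thompsonGen a b 0 := by group
          _ = _ := by rw [e]; group
      have e'' : thompsonGen a b (m + 2 + 2) =
          (thompsonGen a b 2)⁻¹ * (thompsonGen a b (m + 3) * thompsonGen a b 2) := by
        rw [e', inv_mul_cancel_left]
      rw [e'']
      exact h2.inv_right.mul_right ((ih (m + 1) (by omega)).mul_right h2)

/-- For `i = 0` this is the definition of the family; for `i = k + 1` it is the relation with `x₁`,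
conjugated by `x₀ᵏ`. -/
theorem thompsonGen_mul (h2 : Commute a (thompsonGen a b 2))
    (h3 : Commute a (thompsonGen a b 3)) {i j : ℕ} (hij : i < j) :
    thompsonGen a b j * thompsonGen a b i = thompsonGen a b i * thompsonGen a b (j + 1) := by
  match i with
  | 0 =>
    obtain ⟨j, rfl⟩ : ∃ k, j = k + 1 := ⟨j - 1, by omega⟩
    rw [thompsonGen_conj j 1, pow_one]
    group
  | k + 1 =>
    obtain ⟨m, rfl⟩ : ∃ m, j = m + 2 + k := ⟨j - 2 - k, by omega⟩
    have e := thompsonGen_mul_one_of_commute (commute_thompsonGen h2 h3 m)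
    have c1 := thompsonGen_conj (a := a) (b := b) (m + 1) k
    have c2 := thompsonGen_conj (a := a) (b := b) 0 k
    have c3 := thompsonGen_conj (a := a) (b := b) (m + 2) k
    rw [show m + 2 + k + 1 = m + 2 + 1 + k by ring, c3, show m + 2 + k = m + 1 + 1 + k by ring, c1,
      show k + 1 = 0 + 1 + k by ring, c2]
    calc _ = (thompsonGen a b 0 ^ k)⁻¹ * (thompsonGen a b (m + 2) * thompsonGen a b 1) *
              thompsonGen a b 0 ^ k := by simp only [add_assoc, zero_add, Nat.reduceAdd]; group
      _ = _ := by rw [e]; simp only [add_assoc, zero_add, Nat.reduceAdd]; group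

end Relations

/-! ### Normal forms: fractions of sorted positive words. -/

/-- The sorted positive word `x_k ^ a₀ * x_{k+1} ^ a₁ * ⋯` with exponents `[a₀, a₁, …]`. -/
def sortedProd {G : Type*} [Monoid G] (x : ℕ → G) : ℕ → List ℕ → G
  | _, [] => 1
  | k, n :: l => x k ^ n * sortedProd x (k + 1) l

section SortedWords

variable {G : Type*} [Group G] {x : ℕ → G}

theorem map_sortedProd {G' : Type*} [Group G'] (ρ : G →* G') (k : ℕ) (l : List ℕ) :
    ρ (sortedProd x k l) = sortedProd (fun n => ρ (x n)) k l := by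
  induction l generalizing k with
  | nil => simp [sortedProd]
  | cons n l ih => simp [sortedProd, ih]

theorem gen_mul_pow (hx : ∀ i j, i < j → x j * x i = x i * x (j + 1)) {i j : ℕ} (hij : i < j)
    (n : ℕ) : x j * x i ^ n = x i ^ n * x (j + n) := by
  induction n with
  | zero => simp
  | succ n ih =>
    rw [pow_succ, ← mul_assoc, ih, mul_assoc, hx i (j + n) (by omega), ← mul_assoc, add_assoc]

theorem exists_sortedProd_eq_gen (m k : ℕ) : ∃ l, x (k + m) = sortedProd x k l := by
  induction m generalizing k with
  | zero => exact ⟨[1], by simp [sortedProd]⟩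
  | succ m ih =>
    obtain ⟨l, hl⟩ := ih (k + 1)
    refine ⟨0 :: l, ?_⟩
    simp only [sortedProd, pow_zero, one_mul, ← hl]
    congr 1
    ring

/-- The new letter slides right past all powers of smaller generators, its index growing by each
exponent, until it joins the power of its own index. -/
theorem exists_sortedProd_eq_gen_mul (hx : ∀ i j, i < j → x j * x i = x i * x (j + 1))
    {j k : ℕ} (hkj : k ≤ j) (l : List ℕ) :
    ∃ l', x j * sortedProd x k l = sortedProd x k l' := by
  induction l generalizing j k with
  | nil =>
    obtain ⟨m, rfl⟩ := Nat.exists_eq_add_of_le hkj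
    simpa [sortedProd] using exists_sortedProd_eq_gen m k
  | cons n l ih =>
    rcases hkj.eq_or_lt with rfl | h
    · exact ⟨(n + 1) :: l, by rw [sortedProd, sortedProd, pow_succ', mul_assoc]⟩
    · obtain ⟨l', hl'⟩ := ih (j := j + n) (k := k + 1) (by omega)
      exact ⟨n :: l', by rw [sortedProd, sortedProd, ← mul_assoc, gen_mul_pow hx h, mul_assoc, hl']⟩

theorem exists_sortedProd_of_mem_closure (hx : ∀ i j, i < j → x j * x i = x i * x (j + 1))
    {w : G} (hw : w ∈ Submonoid.closure (Set.range x)) : ∃ l, w = sortedProd x 0 l := by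
  induction hw using Submonoid.closure_induction_left with
  | one => exact ⟨[], rfl⟩
  | mul_left y hy w _ ih =>
    obtain ⟨j, rfl⟩ := hy
    obtain ⟨l, rfl⟩ := ih
    exact exists_sortedProd_eq_gen_mul hx j.zero_le l

/-- A single inverse letter moves right through a positive word: `xᵢ⁻¹ xⱼ` is `xⱼ₊₁ xᵢ⁻¹` if `i <
j`, and `xⱼ xᵢ₊₁⁻¹` if `j < i`. It either cancels or comes out as one inverse letter. -/
theorem inv_gen_mul_mem_fractions (hx : ∀ i j, i < j → x j * x i = x i * x (j + 1))
    {w : G} (hw : w ∈ Submonoid.closure (Set.range x)) (i : ℕ) :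
    ∃ p ∈ Submonoid.closure (Set.range x), ∃ q ∈ Submonoid.closure (Set.range x),
      (x i)⁻¹ * w = p * q⁻¹ := by
  have hmem : ∀ n, x n ∈ Submonoid.closure (Set.range x) :=
    fun n => Submonoid.subset_closure ⟨n, rfl⟩
  induction hw using Submonoid.closure_induction_left generalizing i with
  | one => exact ⟨1, one_mem _, x i, hmem i, by simp⟩
  | mul_left y hy w hw ih =>
    obtain ⟨j, rfl⟩ := hy
    rcases lt_trichotomy i j with h | rfl | h
    · obtain ⟨p, hp, q, hq, e⟩ := ih i
      refine ⟨x (j + 1) * p, mul_mem (hmem _) hp, q, hq, ?_⟩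
      rw [mul_assoc, ← e, inv_mul_eq_iff_eq_mul, ← mul_assoc, ← mul_assoc, ← hx i j h,
        mul_inv_cancel_right]
    · exact ⟨w, hw, 1, one_mem _, by simp⟩
    · obtain ⟨p, hp, q, hq, e⟩ := ih (i + 1)
      refine ⟨x j * p, mul_mem (hmem _) hp, q, hq, ?_⟩
      rw [mul_assoc, ← e, inv_mul_eq_iff_eq_mul, ← mul_assoc, ← mul_assoc, hx j i h,
        mul_inv_cancel_right]

/-- The group generated by the `x n` is a group of fractions of its positive monoid. -/
theorem exists_fraction_of_mem_closure (hx : ∀ i j, i < j → x j * x i = x i * x (j + 1))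
    {w : G} (hw : w ∈ Subgroup.closure (Set.range x)) :
    ∃ p ∈ Submonoid.closure (Set.range x), ∃ q ∈ Submonoid.closure (Set.range x),
      w = p * q⁻¹ := by
  induction hw using Subgroup.closure_induction_left with
  | one => exact ⟨1, one_mem _, 1, one_mem _, by simp⟩
  | mul_left y hy w _ ih =>
    obtain ⟨p, hp, q, hq, rfl⟩ := ih
    exact ⟨y * p, mul_mem (Submonoid.subset_closure hy) hp, q, hq, by rw [mul_assoc]⟩
  | inv_mul_cancel y hy w _ ih =>
    obtain ⟨i, rfl⟩ := hy
    obtain ⟨p, hp, q, hq, rfl⟩ := ih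
    obtain ⟨p', hp', q', hq', e⟩ := inv_gen_mul_mem_fractions hx hp i
    exact ⟨p', hp', q * q', mul_mem hq hq', by rw [← mul_assoc, e, mul_inv_rev, mul_assoc]⟩

theorem sortedProd_smul_of_lt {α : Type*} [MulAction G α] {t : ℕ → α}
    (hfix : ∀ i j, i < j → x j • t i = t i) {i k : ℕ} (hik : i < k) (l : List ℕ) :
    sortedProd x k l • t i = t i := by
  induction l generalizing k with
  | nil => simp [sortedProd]
  | cons n l ih =>
    rw [sortedProd, mul_smul, ih (by omega)]
    exact (MulAction.stabilizer G (t i)).pow_mem (hfix i k hik) n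

/-- Sorted positive words are determined by an action in which `x i` moves the point `t i` along
an infinite orbit, while the later generators fix it. -/
theorem sortedProd_eq_of_map_eq {G' α : Type*} [Group G'] [MulAction G' α] (ρ : G →* G')
    {t : ℕ → α} (hfix : ∀ i j, i < j → ρ (x j) • t i = t i)
    (hinj : ∀ i, Function.Injective fun n : ℕ => ρ (x i) ^ n • t i) (k : ℕ) (l l' : List ℕ)
    (h : ρ (sortedProd x k l) = ρ (sortedProd x k l')) : sortedProd x k l = sortedProd x k l' := by
  -- The letters after index `k` fix `t k`, so evaluating at `t k` detects only the leading
  -- exponent, which can then be cancelled.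
  have key : ∀ (k m n : ℕ) (l l' : List ℕ),
      ρ (x k ^ m * sortedProd x (k + 1) l) = ρ (x k ^ n * sortedProd x (k + 1) l') →
      m = n ∧ ρ (sortedProd x (k + 1) l) = ρ (sortedProd x (k + 1) l') := by
    intro k m n l l' h
    have hmn : m = n := by
      apply hinj k
      have := congrArg (· • t k) h
      simpa [map_sortedProd, mul_smul,
        sortedProd_smul_of_lt (x := fun n => ρ (x n)) hfix (Nat.lt_succ_self k)] using this
    subst hmn
    exact ⟨rfl, by simpa using h⟩
  induction l generalizing k l' with
  | nil =>
    induction l' generalizing k with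
    | nil => rfl
    | cons n l' ih =>
      -- The empty list counts as leading exponent 0. Lists may differ by trailing zeros, so only
      -- the products can be compared.
      obtain ⟨rfl, h'⟩ := key k 0 n [] l' (by simpa [sortedProd] using h)
      simpa [sortedProd] using ih (k + 1) h'
  | cons m l ih =>
    cases l' with
    | nil =>
      obtain ⟨rfl, h'⟩ := key k m 0 l [] (by simpa [sortedProd] using h)
      simpa [sortedProd] using ih (k + 1) [] h'
    | cons n l' =>
      obtain ⟨rfl, htail⟩ := key k m n l l' h
      rw [sortedProd, sortedProd, ih (k + 1) l' htail]

/-- A homomorphism is injective if it separates the sorted positive words through an action. -/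
theorem injective_of_separating_orbits {G' α : Type*} [Group G'] [MulAction G' α] (ρ : G →* G')
    (hx : ∀ i j, i < j → x j * x i = x i * x (j + 1)) (hgen : Subgroup.closure (Set.range x) = ⊤)
    {t : ℕ → α} (hfix : ∀ i j, i < j → ρ (x j) • t i = t i)
    (hinj : ∀ i, Function.Injective fun n : ℕ => ρ (x i) ^ n • t i) : Function.Injective ρ := by
  rw [injective_iff_map_eq_one]
  intro w hw
  obtain ⟨p, hp, q, hq, rfl⟩ := exists_fraction_of_mem_closure hx (hgen ▸ Subgroup.mem_top w)
  obtain ⟨l, rfl⟩ := exists_sortedProd_of_mem_closure hx hp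
  obtain ⟨l', rfl⟩ := exists_sortedProd_of_mem_closure hx hq
  rw [map_mul, map_inv, mul_inv_eq_one] at hw
  rw [mul_inv_eq_one]
  exact sortedProd_eq_of_map_eq ρ hfix hinj 0 l l' hw

end SortedWords

/-! ### Extension of automorphisms of `ℝ` by the identity. -/

section ExtendIoo

variable {X : Type*} [LinearOrder X] {p q : X}

open Classical in
/-- Transport an order automorphism of `ℝ` to the interval `Ioo p q`, and extend it by the
identity. -/
noncomputable def extendIooFun (e : ℝ ≃o Set.Ioo p q) (h : ℝ ≃o ℝ) (x : X) : X :=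
  if hx : x ∈ Set.Ioo p q then e (h (e.symm ⟨x, hx⟩)) else x

theorem extendIooFun_coe (e : ℝ ≃o Set.Ioo p q) (h : ℝ ≃o ℝ) (t : ℝ) :
    extendIooFun e h (e t) = e (h t) := by
  simp [extendIooFun, (e t).2]

theorem extendIooFun_of_notMem (e : ℝ ≃o Set.Ioo p q) (h : ℝ ≃o ℝ) {x : X}
    (hx : x ∉ Set.Ioo p q) : extendIooFun e h x = x := by
  simp only [extendIooFun, hx, dite_false]

theorem exists_eq_coe_of_mem_Ioo (e : ℝ ≃o Set.Ioo p q) {x : X} (hx : x ∈ Set.Ioo p q) :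
    ∃ t, x = e t := ⟨e.symm ⟨x, hx⟩, by simp⟩

theorem extendIooFun_mul (e : ℝ ≃o Set.Ioo p q) (h k : ℝ ≃o ℝ) (x : X) :
    extendIooFun e (h * k) x = extendIooFun e h (extendIooFun e k x) := by
  by_cases hx : x ∈ Set.Ioo p q
  · obtain ⟨t, rfl⟩ := exists_eq_coe_of_mem_Ioo e hx
    simp only [extendIooFun_coe, RelIso.mul_apply]
  · simp only [extendIooFun_of_notMem e _ hx]

theorem extendIooFun_one (e : ℝ ≃o Set.Ioo p q) (x : X) : extendIooFun e 1 x = x := by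
  by_cases hx : x ∈ Set.Ioo p q
  · obtain ⟨t, rfl⟩ := exists_eq_coe_of_mem_Ioo e hx
    simp only [extendIooFun_coe, RelIso.one_apply]
  · simp only [extendIooFun_of_notMem e _ hx]

theorem strictMono_extendIooFun (e : ℝ ≃o Set.Ioo p q) (h : ℝ ≃o ℝ) :
    StrictMono (extendIooFun e h) := by
  intro x y hxy
  by_cases hx : x ∈ Set.Ioo p q <;> by_cases hy : y ∈ Set.Ioo p q
  · obtain ⟨s, rfl⟩ := exists_eq_coe_of_mem_Ioo e hx
    obtain ⟨t, rfl⟩ := exists_eq_coe_of_mem_Ioo e hy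
    simp only [extendIooFun_coe]
    simpa using hxy
  · obtain ⟨s, rfl⟩ := exists_eq_coe_of_mem_Ioo e hx
    rw [extendIooFun_coe, extendIooFun_of_notMem e h hy]
    exact (e (h s)).2.2.trans_le (not_lt.1 fun hq => hy ⟨hx.1.trans hxy, hq⟩)
  · obtain ⟨t, rfl⟩ := exists_eq_coe_of_mem_Ioo e hy
    rw [extendIooFun_coe, extendIooFun_of_notMem e h hx]
    exact (not_lt.1 fun hp => hx ⟨hp, hxy.trans hy.2⟩).trans_lt (e (h t)).2.1
  · rwa [extendIooFun_of_notMem e h hx, extendIooFun_of_notMem e h hy]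

/-- Extension by the identity, as a homomorphism of groups of order automorphisms. -/
noncomputable def extendIoo (e : ℝ ≃o Set.Ioo p q) : (ℝ ≃o ℝ) →* (X ≃o X) where
  toFun h := StrictMono.orderIsoOfRightInverse (extendIooFun e h) (strictMono_extendIooFun e h)
    (extendIooFun e h⁻¹) fun x => by rw [← extendIooFun_mul, mul_inv_cancel, extendIooFun_one]
  map_one' := by ext x; exact extendIooFun_one e x
  map_mul' h k := by ext x; exact extendIooFun_mul e h k x

theorem extendIoo_coe (e : ℝ ≃o Set.Ioo p q) (h : ℝ ≃o ℝ) (t : ℝ) :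
    extendIoo e h (e t) = e (h t) := extendIooFun_coe e h t

theorem extendIoo_of_notMem (e : ℝ ≃o Set.Ioo p q) (h : ℝ ≃o ℝ) {x : X}
    (hx : x ∉ Set.Ioo p q) : extendIoo e h x = x := extendIooFun_of_notMem e h hx

theorem extendIoo_injective (e : ℝ ≃o Set.Ioo p q) : Function.Injective (extendIoo e) := by
  intro h k hhk
  ext t
  have := congrArg (fun m : X ≃o X => m (e t)) hhk
  simp only [extendIoo_coe] at this
  exact e.injective (Subtype.ext this)

end ExtendIoo

/-! ### Passage from `ℝ` to the unit interval, and supports. -/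

/-- An explicit order isomorphism from `ℝ` to the interior of the unit interval. -/
noncomputable def realOrderIsoIoo : ℝ ≃o Set.Ioo (0 : I01) 1 :=
  (orderIsoIooNegOneOne ℝ).trans
    { toFun := fun x => ⟨⟨((x : ℝ) + 1) / 2, by linarith [x.2.1], by linarith [x.2.2]⟩,
        Subtype.mk_lt_mk.2 (by linarith [x.2.1]), Subtype.mk_lt_mk.2 (by linarith [x.2.2])⟩
      invFun := fun y => ⟨2 * ((y : I01) : ℝ) - 1, by
        have h : (0 : ℝ) < ((y : I01) : ℝ) := y.2.1
        linarith, by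
        have h : ((y : I01) : ℝ) < (1 : ℝ) := y.2.2
        linarith⟩
      left_inv := fun x => by ext; simp; ring
      right_inv := fun y => by ext; simp
      map_rel_iff' := by
        intro x y
        change ((x : ℝ) + 1) / 2 ≤ ((y : ℝ) + 1) / 2 ↔ (x : ℝ) ≤ y
        constructor <;> intro h <;> linarith }

/-- Order automorphisms of the unit interval are orientation-preserving homeomorphisms. -/
def orderIsoToHomeoPlus : (I01 ≃o I01) →* HomeoPlus where
  toFun h := ⟨h.toHomeomorph, h.strictMono⟩
  map_one' := rfl
  map_mul' _ _ := rfl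

/-- The action of an order automorphism of `ℝ` on the two-point compactification `[0, 1]`. -/
noncomputable def compactify : (ℝ ≃o ℝ) →* HomeoPlus :=
  orderIsoToHomeoPlus.comp (extendIoo realOrderIsoIoo)

theorem compactify_injective : Function.Injective compactify := by
  have h : Function.Injective orderIsoToHomeoPlus := fun h k hhk => by
    ext x
    exact congrArg (fun m : HomeoPlus => (((m : I01 ≃ₜ I01) x : I01) : ℝ)) hhk
  exact h.comp (extendIoo_injective realOrderIsoIoo)

theorem mem_homeoSupp_compactify_coe (h : ℝ ≃o ℝ) (t : ℝ) :
    (realOrderIsoIoo t : I01) ∈ homeoSupp (compactify h) ↔ h t ≠ t := by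
  change extendIoo realOrderIsoIoo h (realOrderIsoIoo t) ≠ _ ↔ _
  rw [extendIoo_coe, Ne, Subtype.coe_inj, realOrderIsoIoo.apply_eq_iff_eq]

theorem homeoSupp_compactify_subset (h : ℝ ≃o ℝ) :
    homeoSupp (compactify h) ⊆ Set.Ioo 0 1 := by
  intro x hx
  by_contra hx'
  exact hx (extendIoo_of_notMem realOrderIsoIoo h hx')

theorem homeoSupp_compactify_of_Iio {h : ℝ ≃o ℝ} {c : ℝ} (hc : ∀ t, h t ≠ t ↔ t < c) :
    homeoSupp (compactify h) = Set.Ioo 0 (realOrderIsoIoo c : I01) := by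
  ext x
  constructor
  · intro hx
    have hx' := homeoSupp_compactify_subset h hx
    obtain ⟨t, rfl⟩ := exists_eq_coe_of_mem_Ioo realOrderIsoIoo hx'
    rw [mem_homeoSupp_compactify_coe, hc] at hx
    exact ⟨hx'.1, by simpa using hx⟩
  · intro hx
    obtain ⟨t, rfl⟩ := exists_eq_coe_of_mem_Ioo realOrderIsoIoo
      ⟨hx.1, hx.2.trans (realOrderIsoIoo c).2.2⟩
    rw [mem_homeoSupp_compactify_coe, hc]
    simpa using hx.2

theorem homeoSupp_compactify_of_Ioi {h : ℝ ≃o ℝ} {b : ℝ} (hb : ∀ t, h t ≠ t ↔ b < t) :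
    homeoSupp (compactify h) = Set.Ioo (realOrderIsoIoo b : I01) 1 := by
  ext x
  constructor
  · intro hx
    have hx' := homeoSupp_compactify_subset h hx
    obtain ⟨t, rfl⟩ := exists_eq_coe_of_mem_Ioo realOrderIsoIoo hx'
    rw [mem_homeoSupp_compactify_coe, hb] at hx
    exact ⟨by simpa using hx, hx'.2⟩
  · intro hx
    obtain ⟨t, rfl⟩ := exists_eq_coe_of_mem_Ioo realOrderIsoIoo
      ⟨(realOrderIsoIoo b).2.1.trans hx.1, hx.2⟩
    rw [mem_homeoSupp_compactify_coe, hb]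
    simpa using hx.1

theorem isTwoChain_compactify {h k : ℝ ≃o ℝ} {b c : ℝ} (hbc : b < c)
    (hc : ∀ t, h t ≠ t ↔ t < c) (hb : ∀ t, k t ≠ t ↔ b < t) :
    IsTwoChain (homeoSupp (compactify h)) (homeoSupp (compactify k)) := by
  have hmem : ∀ t, (realOrderIsoIoo t : I01) ∈ homeoSupp (compactify h) ↔ t < c :=
    fun t => (mem_homeoSupp_compactify_coe h t).trans (hc t)
  have kmem : ∀ t, (realOrderIsoIoo t : I01) ∈ homeoSupp (compactify k) ↔ b < t :=
    fun t => (mem_homeoSupp_compactify_coe k t).trans (hb t)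
  refine ⟨⟨_, _, (realOrderIsoIoo c).2.1, homeoSupp_compactify_of_Iio hc⟩,
    ⟨_, _, (realOrderIsoIoo b).2.2, homeoSupp_compactify_of_Ioi hb⟩, ?_, ?_, ?_⟩
  · obtain ⟨t, ht1, ht2⟩ := exists_between hbc
    exact ⟨realOrderIsoIoo t, (hmem t).2 ht2, (kmem t).2 ht1⟩
  · exact Set.inter_ssubset_left_iff.2 fun hs =>
      lt_irrefl b ((kmem b).1 (hs ((hmem b).2 hbc)))
  · exact Set.inter_ssubset_right_iff.2 fun hs =>
      lt_irrefl c ((hmem c).1 (hs ((kmem c).2 hbc)))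

/-! ### A free pair of order automorphisms of `ℝ`. -/

section PingPong

/-- The periodic piecewise linear map that contracts the complement of the intervals
`[4n + 2, 4n + 3)` into the intervals `[4n, 4n + 1)`. -/
noncomputable def pingFun (x : ℝ) : ℝ :=
  max ((x - 4 * ⌊(x + 1) / 4⌋ + 1) / 3) (3 * (x - 4 * ⌊(x + 1) / 4⌋) - 5) + 4 * ⌊(x + 1) / 4⌋

/-- The inverse of `pingFun`. -/
noncomputable def pingInv (y : ℝ) : ℝ :=
  min (3 * (y - 4 * ⌊y / 4⌋) - 1) ((y - 4 * ⌊y / 4⌋ + 5) / 3) + 4 * ⌊y / 4⌋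

theorem pingFun_eq {x : ℝ} {n : ℤ} (h1 : 4 * n - 1 ≤ x) (h2 : x < 4 * n + 3) :
    pingFun x = max ((x - 4 * n + 1) / 3) (3 * (x - 4 * n) - 5) + 4 * n := by
  have : ⌊(x + 1) / 4⌋ = n := by rw [Int.floor_eq_iff]; constructor <;> linarith
  rw [pingFun, this]

theorem pingInv_eq {y : ℝ} {n : ℤ} (h1 : 4 * n ≤ y) (h2 : y < 4 * n + 4) :
    pingInv y = min (3 * (y - 4 * n) - 1) ((y - 4 * n + 5) / 3) + 4 * n := by
  have : ⌊y / 4⌋ = n := by rw [Int.floor_eq_iff]; constructor <;> linarith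
  rw [pingInv, this]

theorem exists_int_mul_four_sub_one_le (x : ℝ) : ∃ n : ℤ, 4 * n - 1 ≤ x ∧ x < 4 * n + 3 :=
  ⟨⌊(x + 1) / 4⌋, by linarith [Int.floor_le ((x + 1) / 4)],
    by linarith [Int.lt_floor_add_one ((x + 1) / 4)]⟩

theorem exists_int_mul_four_le (y : ℝ) : ∃ n : ℤ, 4 * n ≤ y ∧ y < 4 * n + 4 :=
  ⟨⌊y / 4⌋, by linarith [Int.floor_le (y / 4)], by linarith [Int.lt_floor_add_one (y / 4)]⟩

theorem pingFun_bounds {x : ℝ} {n : ℤ} (h1 : 4 * n - 1 ≤ x) (h2 : x < 4 * n + 3) :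
    4 * n ≤ pingFun x ∧ pingFun x < 4 * n + 4 := by
  rw [pingFun_eq h1 h2]
  constructor
  · linarith [le_max_left ((x - 4 * n + 1) / 3) (3 * (x - 4 * n) - 5)]
  · have : max ((x - 4 * n + 1) / 3) (3 * (x - 4 * n) - 5) < 4 :=
      max_lt (by linarith) (by linarith)
    linarith

theorem pingInv_bounds {y : ℝ} {n : ℤ} (h1 : 4 * n ≤ y) (h2 : y < 4 * n + 4) :
    4 * n - 1 ≤ pingInv y ∧ pingInv y < 4 * n + 3 := by
  rw [pingInv_eq h1 h2]
  constructor
  · have : -1 ≤ min (3 * (y - 4 * n) - 1) ((y - 4 * n + 5) / 3) :=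
      le_min (by linarith) (by linarith)
    linarith
  · linarith [min_le_right (3 * (y - 4 * n) - 1) ((y - 4 * n + 5) / 3)]

theorem pingFun_pingInv (y : ℝ) : pingFun (pingInv y) = y := by
  obtain ⟨n, h1, h2⟩ := exists_int_mul_four_le y
  obtain ⟨h3, h4⟩ := pingInv_bounds h1 h2
  rw [pingFun_eq h3 h4, pingInv_eq h1 h2]
  simp only [max_def, min_def]
  split_ifs <;> linarith

theorem strictMono_pingFun : StrictMono pingFun := by
  intro x y hxy
  obtain ⟨m, h1, h2⟩ := exists_int_mul_four_sub_one_le x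
  obtain ⟨n, h3, h4⟩ := exists_int_mul_four_sub_one_le y
  have hmn : m ≤ n := by
    have : (m : ℝ) < n + 1 := by linarith
    exact_mod_cast Int.lt_add_one_iff.1 (by exact_mod_cast this)
  rcases hmn.eq_or_lt with rfl | hmn
  · rw [pingFun_eq h1 h2, pingFun_eq h3 h4]
    have := max_lt_max (show (x - 4 * m + 1) / 3 < (y - 4 * m + 1) / 3 by linarith)
      (show 3 * (x - 4 * m) - 5 < 3 * (y - 4 * m) - 5 by linarith)
    linarith
  · have : (m : ℝ) + 1 ≤ n := by exact_mod_cast hmn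
    linarith [(pingFun_bounds h1 h2).2, (pingFun_bounds h3 h4).1]

/-- `pingFun` as an order automorphism of `ℝ`. -/
noncomputable def ping : ℝ ≃o ℝ :=
  strictMono_pingFun.orderIsoOfRightInverse pingFun pingInv pingFun_pingInv

/-- In the period `[4n - 1, 4n + 3)` the residues other than 2 fill `[4n - 1, 4n + 2)`, where the
branch of slope 1/3 prevails and the image is `[4n, 4n + 1)`. -/
theorem floor_ping {x : ℝ} (hx : ⌊x⌋ % 4 ≠ 2) : ⌊ping x⌋ % 4 = 0 := by
  obtain ⟨n, h1, h2⟩ := exists_int_mul_four_sub_one_le x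
  have hx2 : x < 4 * n + 2 := by
    by_contra! h
    have : ⌊x⌋ = 4 * n + 2 := by
      rw [Int.floor_eq_iff]; push_cast; constructor <;> linarith
    omega
  have : ⌊ping x⌋ = 4 * n := by
    change ⌊pingFun x⌋ = _
    rw [Int.floor_eq_iff]
    refine ⟨by exact_mod_cast (pingFun_bounds h1 h2).1, ?_⟩
    rw [pingFun_eq h1 h2]
    have : max ((x - 4 * n + 1) / 3) (3 * (x - 4 * n) - 5) < 1 :=
      max_lt (by linarith) (by linarith)
    push_cast
    linarith
  omega

theorem floor_ping_inv {y : ℝ} (hy : ⌊y⌋ % 4 ≠ 0) : ⌊ping⁻¹ y⌋ % 4 = 2 := by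
  by_contra h
  apply hy
  have := floor_ping h
  rwa [← RelIso.mul_apply, mul_inv_cancel, RelIso.one_apply] at this

/-- The translate of `ping` by `1`. -/
noncomputable def pong : ℝ ≃o ℝ :=
  OrderIso.addRight 1 * ping * (OrderIso.addRight 1)⁻¹

theorem pong_apply (x : ℝ) : pong x = ping (x - 1) + 1 := by
  have : (OrderIso.addRight (1 : ℝ))⁻¹ x = x - 1 := by
    change (OrderIso.addRight (1 : ℝ)).symm x = x - 1
    simp [sub_eq_add_neg]
  rw [pong, RelIso.mul_apply, RelIso.mul_apply, this]
  rfl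

theorem floor_pong {x : ℝ} (hx : ⌊x⌋ % 4 ≠ 3) : ⌊pong x⌋ % 4 = 1 := by
  have := floor_ping (x := x - 1) (by rw [Int.floor_sub_one]; omega)
  rw [pong_apply, Int.floor_add_one]
  omega

theorem floor_pong_inv {y : ℝ} (hy : ⌊y⌋ % 4 ≠ 1) : ⌊pong⁻¹ y⌋ % 4 = 3 := by
  by_contra h
  apply hy
  have := floor_pong h
  rwa [← RelIso.mul_apply, mul_inv_cancel, RelIso.one_apply] at this

theorem injective_lift_ping_pong :
    Function.Injective (FreeGroup.lift ![ping, pong]) := by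
  -- The four ping-pong sets are the classes of `⌊x⌋` mod 4: attracting 0 and 1, repelling 2 and 3.
  -- They are unbounded, as they must be to absorb the image of an unbounded set under an increasing
  -- bijection.
  refine FreeGroup.injective_lift_of_ping_pong (α := ℝ) ![ping, pong]
    (fun i => {x | ⌊x⌋ % 4 = (i : ℕ)}) (fun i => {x | ⌊x⌋ % 4 = (i : ℕ) + 2}) ?_ ?_ ?_ ?_ ?_ ?_
  · intro i
    refine ⟨(i : ℕ), ?_⟩
    simp only [Set.mem_ofPred_eq, Int.floor_natCast]
    omega
  · intro i j hij
    rw [Function.onFun, Set.disjoint_left]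
    intro x hx hx'
    simp only [Set.mem_ofPred_eq] at hx hx'
    omega
  · intro i j hij
    rw [Function.onFun, Set.disjoint_left]
    intro x hx hx'
    simp only [Set.mem_ofPred_eq] at hx hx'
    omega
  · intro i j
    rw [Set.disjoint_left]
    intro x hx hx'
    simp only [Set.mem_ofPred_eq] at hx hx'
    omega
  · rintro i _ ⟨x, hx, rfl⟩
    fin_cases i
    · exact floor_ping hx
    · exact floor_pong hx
  · rintro i _ ⟨x, hx, rfl⟩
    fin_cases i
    · exact floor_ping_inv hx
    · exact floor_pong_inv hx

end PingPong

/-! ### Orbits and commutation on the line. -/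

section OrderAutomorphisms

theorem strictAnti_pow_apply {h : ℝ ≃o ℝ} {y : ℝ} (hy : h y < y) :
    StrictAnti fun n : ℕ => (h ^ n) y := by
  refine strictAnti_nat_of_succ_lt fun n => ?_
  rw [pow_succ, RelIso.mul_apply]
  exact (h ^ n).strictMono hy

/-- Both maps fix `c`, hence preserve the two half-lines, and on each half-line one of them is
trivial. -/
theorem commute_of_fixes {h k : ℝ ≃o ℝ} {c : ℝ} (hh : ∀ x, c ≤ x → h x = x)
    (hk : ∀ x, x ≤ c → k x = x) : Commute h k := by
  ext x
  rw [RelIso.mul_apply, RelIso.mul_apply]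
  rcases le_total x c with hx | hx
  · have : h x ≤ c := (h.monotone hx).trans_eq (hh c le_rfl)
    rw [hk x hx, hk _ this]
  · have : c ≤ k x := (hk c le_rfl).symm.trans_le (k.monotone hx)
    rw [hh x hx, hh _ this]

end OrderAutomorphisms

/-! ### Dynamical criterion for generating Thompson's group. -/

section ThompsonAction

/-- `a` moves the points below `c` to the left and fixes the others, `b` moves the points above `p`
to the left and fixes the others, and `(a b)⁻¹` throws `p` at least as far as `c`. -/
structure IsThompsonPair (a b : ℝ ≃o ℝ) (p c : ℝ) : Prop where
  lt : p < c
  a_lt : ∀ x, x < c → a x < x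
  a_fix : ∀ x, c ≤ x → a x = x
  b_lt : ∀ x, p < x → b x < x
  b_fix : ∀ x, x ≤ p → b x = x
  le_inv : c ≤ (a * b)⁻¹ p

namespace IsThompsonPair

variable {a b : ℝ ≃o ℝ} {p c : ℝ}

theorem gen_zero_lt (H : IsThompsonPair a b p c) (x : ℝ) : thompsonGen a b 0 x < x := by
  change a (b x) < x
  rcases le_or_gt x p with hx | hx
  · rw [H.b_fix x hx]
    exact H.a_lt x (hx.trans_lt H.lt)
  · refine lt_of_le_of_lt ?_ (H.b_lt x hx)
    rcases lt_or_ge (b x) c with h | h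
    · exact (H.a_lt _ h).le
    · exact (H.a_fix _ h).le

theorem strictMono_orbit (H : IsThompsonPair a b p c) :
    StrictMono fun n : ℕ => (((a * b) ^ n)⁻¹ : ℝ ≃o ℝ) p := by
  refine strictMono_nat_of_lt_succ fun n => ?_
  rw [← inv_pow, ← inv_pow, pow_succ, RelIso.mul_apply]
  refine ((a * b)⁻¹ ^ n).strictMono ?_
  have := H.gen_zero_lt ((a * b)⁻¹ p)
  rwa [thompsonGen, ← RelIso.mul_apply, mul_inv_cancel, RelIso.one_apply] at this

/-- Conjugation by `(ab)ⁿ` moves the boundary of the support of `b` from `p` to `(ab)⁻ⁿ p`. -/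
theorem gen_succ_fix (H : IsThompsonPair a b p c) (n : ℕ) {x : ℝ}
    (hx : x ≤ (((a * b) ^ n)⁻¹ : ℝ ≃o ℝ) p) :
    thompsonGen a b (n + 1) x = x := by
  have h : ((a * b) ^ n) x ≤ p := by
    have := ((a * b) ^ n).monotone hx
    rwa [← RelIso.mul_apply, mul_inv_cancel, RelIso.one_apply] at this
  rw [thompsonGen, RelIso.mul_apply, RelIso.mul_apply, H.b_fix _ h, ← RelIso.mul_apply,
    inv_mul_cancel, RelIso.one_apply]

theorem gen_succ_lt (H : IsThompsonPair a b p c) (n : ℕ) {x : ℝ}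
    (hx : (((a * b) ^ n)⁻¹ : ℝ ≃o ℝ) p < x) :
    thompsonGen a b (n + 1) x < x := by
  have h : p < ((a * b) ^ n) x := by
    have := ((a * b) ^ n).strictMono hx
    rwa [← RelIso.mul_apply, mul_inv_cancel, RelIso.one_apply] at this
  have := (((a * b) ^ n)⁻¹).strictMono (H.b_lt _ h)
  rwa [← RelIso.mul_apply ((a * b) ^ n)⁻¹ ((a * b) ^ n), inv_mul_cancel, RelIso.one_apply] at this

/-- The support of `x_{n+2}` begins at `(ab)⁻⁽ⁿ⁺¹⁾ p ≥ (ab)⁻¹ p ≥ c`, where that of `a` has ended.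
-/
theorem commute_gen (H : IsThompsonPair a b p c) (n : ℕ) : Commute a (thompsonGen a b (n + 2)) := by
  refine commute_of_fixes H.a_fix fun x hx => H.gen_succ_fix (n + 1) (hx.trans ?_)
  refine H.le_inv.trans ?_
  have := H.strictMono_orbit.monotone (show 1 ≤ n + 1 by omega)
  simpa using this

theorem lift_eq_one (H : IsThompsonPair a b p c) (r : FreeGroup (Fin 2)) (hr : r ∈ thompsonRels) :
    FreeGroup.lift ![a, b] r = 1 := by
  rcases hr with rfl | rfl <;>
    simp only [map_commutatorElement, map_mul, map_inv, map_pow, FreeGroup.lift_apply_of,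
      Matrix.cons_val_zero, Matrix.cons_val_one, commutatorElement_eq_one_iff_commute]
  · exact H.commute_gen 0
  · exact H.commute_gen 1

-- The separating points are `tₙ = (ab)⁻ⁿ p`, an increasing sequence. The support of `x_{n+1}` is
-- `(tₙ, ∞)`: it contains `t_{n+1}` but none of `t₀, …, tₙ`.
open scoped commutatorElement in
theorem injective_toGroup (H : IsThompsonPair a b p c) :
    Function.Injective (PresentedGroup.toGroup (rels := thompsonRels) H.lift_eq_one) := by
  set A : ThompsonF := PresentedGroup.of 0 with hA
  set B : ThompsonF := PresentedGroup.of 1 with hB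
  have hrel : ∀ n : ℕ, n = 1 ∨ n = 2 → Commute A (thompsonGen A B (n + 1)) := by
    intro n hn
    rw [← commutatorElement_eq_one_iff_commute]
    have hmem : ⁅FreeGroup.of (0 : Fin 2), thompsonGen (FreeGroup.of (0 : Fin 2))
        (FreeGroup.of 1) (n + 1)⁆ ∈ thompsonRels := by
      rcases hn with rfl | rfl
      · exact Or.inl rfl
      · exact Or.inr rfl
    exact PresentedGroup.one_of_mem hmem
  have hgen : Subgroup.closure (Set.range (thompsonGen A B)) = ⊤ := by
    rw [eq_top_iff, ← PresentedGroup.closure_range_of, Subgroup.closure_le]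
    have h0 : thompsonGen A B 0 ∈ Subgroup.closure (Set.range (thompsonGen A B)) :=
      Subgroup.subset_closure ⟨0, rfl⟩
    have h1 : B ∈ Subgroup.closure (Set.range (thompsonGen A B)) :=
      Subgroup.subset_closure ⟨1, by simp [thompsonGen]⟩
    rintro _ ⟨i, rfl⟩
    fin_cases i
    · have := mul_mem h0 (inv_mem h1)
      rwa [thompsonGen, mul_inv_cancel_right] at this
    · exact h1
  set ρ := PresentedGroup.toGroup (rels := thompsonRels) H.lift_eq_one with hρ
  have hρA : ρ A = a := by simp [hρ, hA, PresentedGroup.toGroup.of]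
  have hρB : ρ B = b := by simp [hρ, hB, PresentedGroup.toGroup.of]
  have hρgen : ∀ n, ρ (thompsonGen A B n) = thompsonGen a b n := by
    rintro (_ | n) <;> simp [thompsonGen, hρA, hρB]
  refine injective_of_separating_orbits (α := ℝ) (t := fun n => (((a * b) ^ n)⁻¹ : ℝ ≃o ℝ) p) ρ
    (x := thompsonGen A B)
    (fun i j hij => thompsonGen_mul (hrel 1 (Or.inl rfl)) (hrel 2 (Or.inr rfl)) hij)
    hgen ?_ ?_
  · intro i j hij
    obtain ⟨n, rfl⟩ : ∃ n, j = n + 1 := ⟨j - 1, by omega⟩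
    rw [hρgen]
    exact H.gen_succ_fix n (H.strictMono_orbit.monotone (by omega))
  · intro i
    rw [hρgen]
    refine (strictAnti_pow_apply ?_).injective
    match i with
    | 0 => exact H.gen_zero_lt _
    | n + 1 => exact H.gen_succ_lt n (H.strictMono_orbit (Nat.lt_succ_self n))

/-- Any injective image of the group generated by a Thompson pair is Thompson's group. -/
theorem nonempty_mulEquiv (H : IsThompsonPair a b p c) {G : Type*} [Group G]
    {θ : (ℝ ≃o ℝ) →* G} (hθ : Function.Injective θ) :
    Nonempty (Subgroup.closure {θ a, θ b} ≃* ThompsonF) := by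
  have hinj := hθ.comp H.injective_toGroup
  have hrange : (θ.comp (PresentedGroup.toGroup (rels := thompsonRels) H.lift_eq_one)).range =
      Subgroup.closure {θ a, θ b} := by
    rw [MonoidHom.range_eq_map, ← PresentedGroup.closure_range_of, MonoidHom.map_closure,
      ← Set.range_comp]
    congr 1
    ext y
    simp [PresentedGroup.toGroup.of, eq_comm]
  exact ⟨(MulEquiv.subgroupCongr hrange.symm).trans (MonoidHom.ofInjective hinj).symm⟩

end IsThompsonPair

end ThompsonAction

/-! ### The explicit square root and its free subgroup. -/

section Construction

/-- The translation by `4` below `5`, slowing down towards the fixed half-line above `13`. -/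
noncomputable def leftMap : ℝ ≃o ℝ :=
  StrictMono.orderIsoOfRightInverse (fun x => max x (min (x + 4) ((x + 13) / 2)))
    (fun x y hxy => max_lt_max hxy (min_lt_min (by linarith) (by linarith)))
    (fun y => min y (max (y - 4) (2 * y - 13)))
    (fun y => by simp only [max_def, min_def]; split_ifs <;> linarith)

theorem leftMap_apply (x : ℝ) : leftMap x = max x (min (x + 4) ((x + 13) / 2)) := rfl

theorem leftMap_of_le {x : ℝ} (hx : x ≤ 5) : leftMap x = x + 4 := by
  rw [leftMap_apply, min_eq_left (by linarith), max_eq_right (by linarith)]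

theorem leftMap_of_ge {x : ℝ} (hx : 13 ≤ x) : leftMap x = x := by
  rw [leftMap_apply, max_eq_left (min_le_of_right_le (by linarith))]

theorem lt_leftMap {x : ℝ} (hx : x < 13) : x < leftMap x := by
  rw [leftMap_apply]
  exact lt_max_of_lt_right (lt_min (by linarith) (by linarith))

/-- The translation by `4` on `[-1, 5]`, slowing down towards the fixed half-line below `-5`. -/
noncomputable def rightMap : ℝ ≃o ℝ :=
  StrictMono.orderIsoOfRightInverse
    (fun x => max (min (max x (2 * x + 5)) (x + 4)) (2 * x - 1))
    (fun x y hxy => max_lt_max (min_lt_min (max_lt_max hxy (by linarith)) (by linarith))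
      (by linarith))
    (fun y => min (max (min y ((y - 5) / 2)) (y - 4)) ((y + 1) / 2))
    (fun y => by simp only [max_def, min_def]; split_ifs <;> linarith)

theorem rightMap_apply (x : ℝ) :
    rightMap x = max (min (max x (2 * x + 5)) (x + 4)) (2 * x - 1) := rfl

theorem rightMap_of_le {x : ℝ} (hx : x ≤ -5) : rightMap x = x := by
  rw [rightMap_apply, max_eq_left (a := x) (by linarith), min_eq_left (by linarith),
    max_eq_left (by linarith)]

theorem rightMap_of_mem {x : ℝ} (hx : x ∈ Set.Icc (-1) 5) : rightMap x = x + 4 := by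
  obtain ⟨h1, h2⟩ := hx
  rw [rightMap_apply, max_eq_right (a := x) (by linarith), min_eq_right (by linarith),
    max_eq_left (by linarith)]

theorem lt_rightMap {x : ℝ} (hx : -5 < x) : x < rightMap x := by
  rw [rightMap_apply]
  exact lt_max_of_lt_left (lt_min (lt_max_of_lt_right (by linarith)) (by linarith))

/-- Acts as `ping` on `(-1, 1)` and as `pong` on `(3, 5)`, in suitable coordinates. -/
noncomputable def twist : ℝ ≃o ℝ :=
  extendIoo (orderIsoIooNegOneOne ℝ) ping * (OrderIso.addRight 4 *
    extendIoo (orderIsoIooNegOneOne ℝ) pong * (OrderIso.addRight 4)⁻¹)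

theorem twist_apply (x : ℝ) : twist x = extendIoo (orderIsoIooNegOneOne ℝ) ping
    (extendIoo (orderIsoIooNegOneOne ℝ) pong (x - 4) + 4) := by
  have : (OrderIso.addRight (4 : ℝ))⁻¹ x = x - 4 := by
    change (OrderIso.addRight (4 : ℝ)).symm x = x - 4
    simp [sub_eq_add_neg]
  simp only [twist, RelIso.mul_apply, this]
  rfl

theorem twist_coe (t : ℝ) :
    twist (orderIsoIooNegOneOne ℝ t) = orderIsoIooNegOneOne ℝ (ping t) := by
  have h := (orderIsoIooNegOneOne ℝ t).2
  rw [twist_apply, extendIoo_of_notMem _ pong (fun h' => by linarith [h.2, h'.1]), sub_add_cancel,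
    extendIoo_coe]

theorem twist_coe_add (t : ℝ) :
    twist (orderIsoIooNegOneOne ℝ t + 4) = orderIsoIooNegOneOne ℝ (pong t) + 4 := by
  have h := (orderIsoIooNegOneOne ℝ (pong t)).2
  rw [twist_apply, add_sub_cancel_right, extendIoo_coe,
    extendIoo_of_notMem _ ping (fun h' => by linarith [h.1, h'.2])]

theorem twist_of_notMem {x : ℝ} (h1 : x ∉ Set.Ioo (-1) 1) (h2 : x ∉ Set.Ioo 3 5) :
    twist x = x := by
  rw [twist_apply, extendIoo_of_notMem _ pong (fun h => h2 ⟨by linarith [h.1], by linarith [h.2]⟩),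
    sub_add_cancel, extendIoo_of_notMem _ ping h1]

/-- The second generator: `rightMap` twisted by the ping-pong maps. -/
noncomputable def twistedMap : ℝ ≃o ℝ := rightMap * twist

theorem twistedMap_coe (t : ℝ) :
    twistedMap (orderIsoIooNegOneOne ℝ t) = orderIsoIooNegOneOne ℝ (ping t) + 4 := by
  have h := (orderIsoIooNegOneOne ℝ (ping t)).2
  rw [twistedMap, RelIso.mul_apply, twist_coe, rightMap_of_mem ⟨h.1.le, by linarith [h.2]⟩]

theorem twistedMap_coe_add (t : ℝ) :
    twistedMap (orderIsoIooNegOneOne ℝ t + 4) = orderIsoIooNegOneOne ℝ (pong t) + 8 := by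
  have h := (orderIsoIooNegOneOne ℝ (pong t)).2
  rw [twistedMap, RelIso.mul_apply, twist_coe_add,
    rightMap_of_mem ⟨by linarith [h.1], by linarith [h.2]⟩]
  ring

theorem twistedMap_of_notMem {x : ℝ} (h1 : x ∉ Set.Ioo (-1) 1) (h2 : x ∉ Set.Ioo 3 5) :
    twistedMap x = rightMap x := by
  rw [twistedMap, RelIso.mul_apply, twist_of_notMem h1 h2]

theorem twistedMap_of_le {x : ℝ} (hx : x ≤ -5) : twistedMap x = x := by
  rw [twistedMap_of_notMem (fun h => by linarith [h.1]) (fun h => by linarith [h.1]),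
    rightMap_of_le hx]

/-- The twist permutes the points of intervals of length 2, while `rightMap` translates these by 4,
so no fixed point can arise. -/
theorem lt_twistedMap {x : ℝ} (hx : -5 < x) : x < twistedMap x := by
  by_cases h1 : x ∈ Set.Ioo (-1) 1
  · obtain ⟨t, rfl⟩ := exists_eq_coe_of_mem_Ioo (orderIsoIooNegOneOne ℝ) h1
    rw [twistedMap_coe]
    linarith [h1.2, (orderIsoIooNegOneOne ℝ (ping t)).2.1]
  by_cases h2 : x ∈ Set.Ioo 3 5
  · obtain ⟨t, ht⟩ := exists_eq_coe_of_mem_Ioo (orderIsoIooNegOneOne ℝ)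
      (x := x - 4) ⟨by linarith [h2.1], by linarith [h2.2]⟩
    obtain rfl : x = orderIsoIooNegOneOne ℝ t + 4 := by linarith
    rw [twistedMap_coe_add]
    linarith [h2.2, (orderIsoIooNegOneOne ℝ (pong t)).2.1]
  rw [twistedMap_of_notMem h1 h2]
  exact lt_rightMap hx

theorem leftMap_inv_ne_iff (t : ℝ) : leftMap⁻¹ t ≠ t ↔ t < 13 := by
  change leftMap.symm t ≠ t ↔ _
  rw [Ne, OrderIso.symm_apply_eq, ← not_le, not_iff_not]
  refine ⟨fun h => ?_, fun h => (leftMap_of_ge h).symm⟩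
  by_contra! h'
  exact (lt_leftMap h').ne h

theorem twistedMap_inv_ne_iff (t : ℝ) : twistedMap⁻¹ t ≠ t ↔ -5 < t := by
  change twistedMap.symm t ≠ t ↔ _
  rw [Ne, OrderIso.symm_apply_eq, ← not_le, not_iff_not]
  refine ⟨fun h => ?_, fun h => (twistedMap_of_le h).symm⟩
  by_contra! h'
  exact (lt_twistedMap h').ne h

theorem sq_inv_apply_lt {h : ℝ ≃o ℝ} {x : ℝ} (hx : h⁻¹ x < x) : (h⁻¹ ^ 2) x < x := by
  simpa using strictAnti_pow_apply hx (show 0 < 2 by norm_num)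

theorem isThompsonPair_leftMap_twistedMap :
    IsThompsonPair (leftMap⁻¹ ^ 2) (twistedMap⁻¹ ^ 2) (-5) 13 where
  lt := by norm_num
  a_lt x hx := sq_inv_apply_lt (leftMap.symm_apply_lt.2 (lt_leftMap hx))
  a_fix x hx := by
    have : leftMap⁻¹ x = x := not_not.1 fun h => hx.not_gt ((leftMap_inv_ne_iff x).1 h)
    rw [sq, RelIso.mul_apply, this, this]
  b_lt x hx := sq_inv_apply_lt (twistedMap.symm_apply_lt.2 (lt_twistedMap hx))
  b_fix x hx := by
    have : twistedMap⁻¹ x = x := not_not.1 fun h => hx.not_gt ((twistedMap_inv_ne_iff x).1 h)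
    rw [sq, RelIso.mul_apply, this, this]
  le_inv := by
    -- The itinerary of `p` under two steps of each map is `-5 → -1 → 3 → 7 → 13`, ending exactly at
    -- `c`. The points 3 and 7, where `twistedMap` is applied, lie outside the open intervals of the
    -- twist.
    have h3 : twistedMap 3 = 7 := by
      rw [twistedMap_of_notMem (by norm_num) (by norm_num), rightMap_of_mem (by norm_num)]
      norm_num
    have h7 : twistedMap 7 = 13 := by
      rw [twistedMap_of_notMem (by norm_num) (by norm_num), rightMap_apply]
      norm_num
    rw [mul_inv_rev, inv_pow, inv_pow, inv_inv, inv_inv, sq, sq]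
    simp only [RelIso.mul_apply]
    rw [leftMap_of_le (x := -5) (by norm_num), leftMap_of_le (by norm_num),
      show (-5 + 4 + 4 : ℝ) = 3 by norm_num, h3, h7]

/-- If `u i` preserves the interval parametrized by `e` and acts on it as `w i`, and the `w i` are
free generators, then so are the `u i`. -/
theorem injective_lift_of_semiconj {ι X Y : Type*} [LE X] [LE Y] {e : X → Y}
    (he : Function.Injective e) {u : ι → (Y ≃o Y)} {w : ι → (X ≃o X)}
    (huw : ∀ i t, u i (e t) = e (w i t)) (hw : Function.Injective (FreeGroup.lift w)) :
    Function.Injective (FreeGroup.lift u) := by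
  have key : ∀ (x : FreeGroup ι) (t : X), FreeGroup.lift u x (e t) = e (FreeGroup.lift w x t) := by
    intro x
    induction x using FreeGroup.induction_on with
    | C1 => intro t; simp
    | of i => intro t; simpa using huw i t
    | inv_of i ih =>
      intro t
      simp only [map_inv, FreeGroup.lift_apply_of] at ih ⊢
      change (u i).symm (e t) = _
      rw [OrderIso.symm_apply_eq, huw, ← RelIso.mul_apply, mul_inv_cancel, RelIso.one_apply]
    | mul x y hx hy => intro t; rw [map_mul, map_mul, RelIso.mul_apply, RelIso.mul_apply, hy, hx]
  rw [injective_iff_map_eq_one]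
  intro x hx
  apply (injective_iff_map_eq_one _).1 hw
  ext t
  apply he
  rw [← key, hx]
  rfl

/-- On `(-1, 1)` the first word goes out to `(3, 5)` by `ping` plus 4 and returns. The second is
carried to `(3, 5)`, then to `(7, 9)` with `pong` applied on the way, and back by two inverse
translations. -/
theorem injective_lift_leftMap_twistedMap :
    Function.Injective (FreeGroup.lift
      ![leftMap⁻¹ * twistedMap, leftMap⁻¹ * (leftMap⁻¹ * twistedMap) * leftMap]) := by
  refine injective_lift_of_semiconj (e := fun t => (orderIsoIooNegOneOne ℝ t : ℝ))
    (Subtype.val_injective.comp (orderIsoIooNegOneOne ℝ).injective) ?_ injective_lift_ping_pong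
  have hmem := fun t => (orderIsoIooNegOneOne ℝ t).2
  intro i t
  fin_cases i
  · change leftMap.symm (twistedMap _) = (orderIsoIooNegOneOne ℝ (ping t) : ℝ)
    rw [OrderIso.symm_apply_eq, twistedMap_coe, leftMap_of_le (by linarith [(hmem (ping t)).2])]
  · change leftMap.symm (leftMap.symm (twistedMap (leftMap _))) =
      (orderIsoIooNegOneOne ℝ (pong t) : ℝ)
    have h := (hmem (pong t)).2
    rw [OrderIso.symm_apply_eq, OrderIso.symm_apply_eq, leftMap_of_le (by linarith [(hmem t).2]),
      twistedMap_coe_add, leftMap_of_le (x := orderIsoIooNegOneOne ℝ (pong t)) (by linarith),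
      leftMap_of_le (by linarith)]
    ring

end Construction

theorem corollary1p6 :
    ∃ G : Subgroup HomeoPlus, IsSquareRootOfF G ∧
      ∃ φ : FreeGroup (Fin 2) →* G, Function.Injective φ := by
  refine ⟨Subgroup.closure {compactify leftMap⁻¹, compactify twistedMap⁻¹},
    ⟨_, _, rfl, isTwoChain_compactify (by norm_num) leftMap_inv_ne_iff twistedMap_inv_ne_iff, ?_⟩,
    ?_⟩
  · rw [← map_pow, ← map_pow]
    exact isThompsonPair_leftMap_twistedMap.nonempty_mulEquiv compactify_injective
  · have hf : compactify leftMap⁻¹ ∈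
        Subgroup.closure {compactify leftMap⁻¹, compactify twistedMap⁻¹} :=
      Subgroup.subset_closure (by simp)
    have hg : compactify twistedMap⁻¹ ∈
        Subgroup.closure {compactify leftMap⁻¹, compactify twistedMap⁻¹} :=
      Subgroup.subset_closure (by simp)
    have hf' : compactify leftMap ∈
        Subgroup.closure {compactify leftMap⁻¹, compactify twistedMap⁻¹} := by
      simpa using inv_mem hf
    have hg' : compactify twistedMap ∈
        Subgroup.closure {compactify leftMap⁻¹, compactify twistedMap⁻¹} := by
      simpa using inv_mem hg
    set θ := compactify.comp (FreeGroup.lift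
      ![leftMap⁻¹ * twistedMap, leftMap⁻¹ * (leftMap⁻¹ * twistedMap) * leftMap]) with hθ
    have hrange : ∀ w, θ w ∈ Subgroup.closure {compactify leftMap⁻¹, compactify twistedMap⁻¹} := by
      intro w
      induction w using FreeGroup.induction_on with
      | C1 => simp
      | of i =>
        fin_cases i
        · simpa [hθ] using mul_mem hf hg'
        · simpa [hθ] using mul_mem (mul_mem hf (mul_mem hf hg')) hf'
      | inv_of i ih => rw [map_inv]; exact inv_mem ih
      | mul x y hx hy => rw [map_mul]; exact mul_mem hx hy
    refine ⟨θ.codRestrict _ hrange, fun v w hvw => ?_⟩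
    exact (compactify_injective.comp injective_lift_leftMap_twistedMap) (congrArg Subtype.val hvw)
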